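/- Let $\Bbbk$ be a field, let $0\le r\le n$ be integers, and let $W\subseteq\Bbbk^{n}$ be a linear realization of the uniform matroid $U_{r,n}$ on $[n]=\{1,\dots,n\}$; that is, for $B\subseteq[n]$, the coordinate projection $W\to\Bbbk^{B}$ is an isomorphism if and only if $|B|=r$. Let $W^\perp=\{y\in\Bbbk^{n} : \sum_i w_iy_i=0\text{ for all }w\in W\}$. Let $R=\operatorname{Sym}(W^*)$ and $R^\perp=\operatorname{Sym}((W^\perp)^*)$ be the coordinate rings of $W$ and $W^\perp$, put $S=R\otimes_\Bbbk R^\perp$, and let $f_i\in R$ and $g_i\in R^\perp$ be the restrictions of the $i$-th coordinate function to $W$ and to $W^\perp$, regarded as elements of $S$. Let $\mathfrak a=(f_1g_1,\dots,f_ng_n)\subseteq S$ be the ideal of pairs of $W$, and for $I,J\subseteq[n]$ put $\mathfrak p_{I,J}=(f_i : i\in I)+(g_j : j\in J)\subseteq S$. Then every associated prime of $S/\mathfrak a$ is one of $\mathfrak p_{[n],\emptyset}$, $\mathfrak p_{\emptyset,[n]}$ and $\mathfrak p_{[n],[n]}$. Moreover, if $0<r<n$, then $\mathfrak p_{[n],\emptyset}$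 and $\mathfrak p_{\emptyset,[n]}$ are associated primes of $S/\mathfrak a$, and $\mathfrak p_{[n],[n]}$ is an associated prime of $S/\mathfrak a$ if and only if $2\le r\le n-2$. -/

import Mathlib

/-!
Put `𝔭 = (f_1, …, f_n)` and `𝔮 = (g_1, …, g_n)`. These are primes and `𝔪 = 𝔭 + 𝔮` is maximal. For a
prime `P ⊇ (𝔞 : 𝔮)`, let `T` be the set of those `i` with `f_i ∈ P`. By uniformity, `𝔭` is generated
by the `f_i` with `i ∈ T`, or `𝔮` by the `g_i` with `i ∉ T`. The latter would put the product of the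
`f_i` with `i ∉ T` into `(𝔞 : 𝔮) ⊆ P`, so `𝔭 ⊆ P`. Hence `𝔭 ⊆ √(𝔞 : 𝔮)` and, by symmetry,
`𝔮 ⊆ √(𝔞 : 𝔭)`, so that `𝔪 ⊆ √(𝔞 : 𝔭 ∩ 𝔮)`: away from the origin, `𝔞` is `𝔭 ∩ 𝔮`. The exact sequence
`0 → (𝔭 ∩ 𝔮)/𝔞 → S/𝔞 → S/(𝔭 ∩ 𝔮) → 0` then leaves only `𝔭`, `𝔮`, `𝔪` as candidates.
If `0 < r < n`, then `𝔭` and `𝔮` are incomparable, hence minimal over `𝔞`, and `𝔪` is associated iff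
`𝔭 ∩ 𝔮 ⊄ 𝔞`.

If `r = 1`, each `f_i` generates `𝔭`, so that `𝔭 ∩ 𝔮 ⊆ 𝔞`; dually for `r = n - 1`. In all other
cases, `𝔭 ∩ 𝔮` has dimension `r (n - r) ≥ n` in bidegree `(1, 1)`, where `𝔞` is spanned by
`f_1 g_1, …, f_n g_n`, which are linearly dependent because `∑ i, f_i g_i = 0`.
-/

open scoped TensorProduct

namespace IdealOfPairs

/-- The uniform matroid `U_{r,n}` on the ground set `Fin n`: a set is independent iff it has at
most `r` elements. -/
def uniformMatroid (r n : ℕ) : Matroid (Fin n) :=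
  (IndepMatroid.ofFinite (E := Set.univ) Set.finite_univ (fun I : Set (Fin n) => I.ncard ≤ r)
    (by simp)
    (fun _ J hJ hIJ => (Set.ncard_le_ncard hIJ J.toFinite).trans hJ)
    (by
      intro I J _ hJ hIJ
      obtain ⟨e, heJ, heI⟩ := Set.exists_mem_notMem_of_ncard_lt_ncard hIJ I.toFinite
      refine ⟨e, heJ, heI, ?_⟩
      rw [Set.ncard_insert_of_notMem heI I.toFinite]
      omega)
    (fun I _ => Set.subset_univ I)).matroid

section

variable {k : Type*} [Field k] {n : ℕ}

/-- `W ⊆ kⁿ` is a linear realization of the matroid `M` on `[n]`: the coordinate projection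
`W → k^B` is an isomorphism iff `B` is a basis of `M`. -/
def IsRealization (W : Submodule k (Fin n → k)) (M : Matroid (Fin n)) : Prop :=
  M.E = Set.univ ∧ ∀ B : Set (Fin n),
    Function.Bijective (fun (w : W) (i : B) => (w : Fin n → k) i) ↔ M.IsBase B

/-- `W^⊥ = (kⁿ/W)^*`, regarded as a subspace of `kⁿ` through the standard basis. -/
def perp (W : Submodule k (Fin n → k)) : Submodule k (Fin n → k) where
  carrier := {y | ∀ w ∈ W, ∑ i, w i * y i = 0}
  zero_mem' := by simp
  add_mem' := by
    intro a b ha hb w hw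
    simp [mul_add, Finset.sum_add_distrib, ha w hw, hb w hw]
  smul_mem' := by
    intro c a ha w hw
    have h := ha w hw
    simp only [Pi.smul_apply, smul_eq_mul, mul_left_comm _ c, ← Finset.mul_sum, h, mul_zero]

/-- The (polynomial) coordinate ring `k[V] = Sym(V^*)` of a subspace `V ⊆ kⁿ`. -/
abbrev CoordRing (V : Submodule k (Fin n → k)) : Type _ :=
  SymmetricAlgebra k (Module.Dual k V)

/-- The restriction to `V` of the `i`-th coordinate function of `kⁿ`, as an element of `k[V]`. -/
noncomputable def coord (V : Submodule k (Fin n → k)) (i : Fin n) : CoordRing V :=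
  SymmetricAlgebra.ι k (Module.Dual k V) ((LinearMap.proj i : (Fin n → k) →ₗ[k] k) ∘ₗ V.subtype)

/-- `S = R ⊗ R^⊥`, where `R = k[W]` and `R^⊥ = k[W^⊥]`. -/
abbrev PairRing (W : Submodule k (Fin n → k)) : Type _ :=
  CoordRing W ⊗[k] CoordRing (perp W)

/-- `f_i`, the restriction of the `i`-th coordinate to `W`, in `S`. -/
noncomputable def f (W : Submodule k (Fin n → k)) (i : Fin n) : PairRing W :=
  coord W i ⊗ₜ[k] 1

/-- `g_i`, the restriction of the `i`-th coordinate to `W^⊥`, in `S`. -/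
noncomputable def g (W : Submodule k (Fin n → k)) (i : Fin n) : PairRing W :=
  1 ⊗ₜ[k] coord (perp W) i

/-- The ideal of pairs `𝔞 = (f_1 g_1, …, f_n g_n)`. -/
noncomputable def pairIdeal (W : Submodule k (Fin n → k)) : Ideal (PairRing W) :=
  Ideal.span (Set.range fun i => f W i * g W i)

/-- The linear ideal `𝔭_{I,J} = (f_i : i ∈ I) + (g_j : j ∈ J)`. -/
noncomputable def linIdeal (W : Submodule k (Fin n → k)) (I J : Set (Fin n)) :
    Ideal (PairRing W) :=
  Ideal.span (f W '' I) ⊔ Ideal.span (g W '' J)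

end

end IdealOfPairs

namespace IdealOfPairs

section AssociatedPrimes

variable {S M : Type*} [CommRing S] [AddCommGroup M] [Module S M]

theorem associatedPrimes_quotient_subset_union {N J : Submodule S M} (hNJ : N ≤ J) :
    associatedPrimes S (M ⧸ N) ⊆
      associatedPrimes S (J.map N.mkQ) ∪ associatedPrimes S (M ⧸ J) := by
  refine associatedPrimes.subset_union_of_exact (f := (J.map N.mkQ).subtype)
    (g := Submodule.factor hNJ) (Submodule.subtype_injective _) (LinearMap.exact_iff.2 ?_)
  rw [Submodule.range_subtype, Submodule.ker_mapQ, Submodule.comap_id]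

theorem associatedPrimes_map_mkQ_subset_singleton {N J : Submodule S M} {m : Ideal S}
    (hm : m.IsMaximal) (hmJ : m ≤ (N.colon (J : Set M)).radical) :
    associatedPrimes S (J.map N.mkQ) ⊆ {m} := by
  intro P hP
  have hann : N.colon (J : Set M) ≤ P := by
    simpa only [Submodule.annihilator_top, ← Submodule.annihilator_map_mkQ_eq_colon] using
      hP.annihilator_le
  exact (hm.eq_of_le hP.isPrime.ne_top (hmJ.trans (hP.isPrime.radical_le_iff.2 hann))).symm

theorem mem_associatedPrimes_quotient_iff_not_le [IsNoetherianRing S] {N J : Submodule S M}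
    {m : Ideal S} (hm : m.IsMaximal) (hmJ : m ≤ (N.colon (J : Set M)).radical) (hNJ : N ≤ J)
    (hmem : m ∉ associatedPrimes S (M ⧸ J)) :
    m ∈ associatedPrimes S (M ⧸ N) ↔ ¬ J ≤ N := by
  have hle : J ≤ N ↔ J.map N.mkQ = ⊥ := by rw [← LinearMap.le_ker_iff_map, Submodule.ker_mkQ]
  rw [hle, ← ne_eq, ← Submodule.nontrivial_iff_ne_bot]
  constructor
  · intro hmN
    have hmJN := (associatedPrimes_quotient_subset_union hNJ hmN).resolve_right hmem
    by_contra hnt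
    rw [not_nontrivial_iff_subsingleton] at hnt
    exact not_isAssociatedPrime_of_subsingleton hmJN
  · intro _
    obtain ⟨P, hP⟩ := associatedPrimes.nonempty S (J.map N.mkQ)
    obtain rfl := associatedPrimes_map_mkQ_subset_singleton hm hmJ hP
    exact associatedPrimes.subset_of_injective (Submodule.subtype_injective _) hP

theorem associatedPrimes_quotient_inf_subset {p q : Ideal S} (hp : p.IsPrime) (hq : q.IsPrime) :
    associatedPrimes S (S ⧸ p ⊓ q) ⊆ {p, q} := by
  have hinj : Function.Injective ((p ⊓ q).liftQ (p.mkQ.prod q.mkQ) (by simp)) :=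
    LinearMap.ker_eq_bot.1 (Submodule.ker_liftQ_eq_bot _ _ _ (by simp))
  intro P hP
  have hP' := associatedPrimes.subset_of_injective hinj hP
  rw [associatedPrimes.prod] at hP'
  exact hP'.imp (fun h => (h.eq_radical hp.isPrimary).trans hp.radical)
    fun h => (h.eq_radical hq.isPrimary).trans hq.radical

variable {a p q : Ideal S}

theorem associatedPrimes_quotient_subset_of_sup_le_radical (hp : p.IsPrime) (hq : q.IsPrime)
    (hm : (p ⊔ q).IsMaximal) (ha : a ≤ p ⊓ q)
    (hcolon : p ⊔ q ≤ (a.colon (p ⊓ q : Ideal S)).radical) :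
    associatedPrimes S (S ⧸ a) ⊆ {p, q, p ⊔ q} := by
  intro P hP
  rcases associatedPrimes_quotient_subset_union ha hP with h | h
  · exact .inr (.inr (associatedPrimes_map_mkQ_subset_singleton hm hcolon h))
  · exact (associatedPrimes_quotient_inf_subset hp hq h).imp_right .inl

theorem mem_minimalPrimes_of_sup_le_radical (hp : p.IsPrime) (ha : a ≤ p) (hqp : ¬ q ≤ p)
    (hcolon : p ⊔ q ≤ (a.colon (p ⊓ q : Ideal S)).radical) : p ∈ a.minimalPrimes := by
  refine ⟨⟨hp, ha⟩, fun P ⟨hP, haP⟩ hPp => ?_⟩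
  have hqP : ¬ q ≤ P := fun h => hqp (h.trans hPp)
  have hcP : ¬ a.colon (p ⊓ q : Ideal S) ≤ P := fun h =>
    hqP (le_sup_right.trans (hcolon.trans (hP.radical_le_iff.2 h)))
  obtain ⟨c, hc, hcP⟩ := SetLike.not_le_iff_exists.1 hcP
  have hinf : p ⊓ q ≤ P := fun y hy =>
    (hP.mem_or_mem (haP (Submodule.mem_colon.1 hc y hy))).resolve_left hcP
  exact (hP.inf_le.1 hinf).resolve_right hqP

theorem sup_mem_associatedPrimes_quotient_iff [IsNoetherianRing S] (hp : p.IsPrime)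
    (hq : q.IsPrime) (hm : (p ⊔ q).IsMaximal) (ha : a ≤ p ⊓ q) (hpq : ¬ p ≤ q) (hqp : ¬ q ≤ p)
    (hcolon : p ⊔ q ≤ (a.colon (p ⊓ q : Ideal S)).radical) :
    p ⊔ q ∈ associatedPrimes S (S ⧸ a) ↔ ¬ p ⊓ q ≤ a := by
  refine mem_associatedPrimes_quotient_iff_not_le hm hcolon ha fun h => ?_
  rcases associatedPrimes_quotient_inf_subset hp hq h with h | h
  · exact hqp (sup_eq_left.1 h)
  · exact hpq (sup_eq_right.1 h)

theorem minimalPrimes_subset_associatedPrimes_quotient [IsNoetherianRing S] (a : Ideal S) :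
    a.minimalPrimes ⊆ associatedPrimes S (S ⧸ a) := by
  simpa only [Ideal.annihilator_quotient] using
    Module.associatedPrimes.minimalPrimes_annihilator_subset_associatedPrimes S (S ⧸ a)

end AssociatedPrimes

section Products

variable {S ι : Type*} [CommRing S] {f g : ι → S}

theorem span_range_mul_le_inf :
    Ideal.span (Set.range (f * g)) ≤ Ideal.span (Set.range f) ⊓ Ideal.span (Set.range g) := by
  rw [Ideal.span_le]
  rintro _ ⟨i, rfl⟩
  exact ⟨Ideal.mul_mem_right _ _ (Ideal.subset_span ⟨i, rfl⟩),
    Ideal.mul_mem_left _ _ (Ideal.subset_span ⟨i, rfl⟩)⟩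

theorem prod_mem_colon_span_image (s : Finset ι) :
    ∏ i ∈ s, f i ∈ (Ideal.span (Set.range (f * g))).colon (Ideal.span (g '' s) : Ideal S) := by
  classical
  rw [Ideal.colon_span, Submodule.mem_colon]
  rintro _ ⟨i, hi, rfl⟩
  rw [smul_eq_mul, ← Finset.prod_erase_mul s f hi, mul_assoc]
  exact Ideal.mul_mem_left _ _ (Ideal.subset_span ⟨i, rfl⟩)

theorem span_range_left_le_radical_colon [Finite ι]
    (h : ∀ T : Set ι, Ideal.span (Set.range f) ≤ Ideal.span (f '' T) ∨
      Ideal.span (Set.range g) ≤ Ideal.span (g '' Tᶜ)) :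
    Ideal.span (Set.range f) ≤
      ((Ideal.span (Set.range (f * g))).colon (Ideal.span (Set.range g) : Ideal S)).radical := by
  classical
  have := Fintype.ofFinite ι
  rw [Ideal.radical_eq_sInf]
  refine le_sInf fun P ⟨hcolon, hP⟩ => ?_
  rcases h {i | f i ∈ P} with hf | hg
  · exact hf.trans (Ideal.span_le.2 (Set.image_subset_iff.2 fun i hi => hi))
  · have hprod : ∏ i with f i ∉ P, f i ∈ P := by
      refine hcolon (Submodule.colon_mono le_rfl hg ?_)
      convert prod_mem_colon_span_image (f := f) (g := g) {i | f i ∉ P}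
      ext; simp
    obtain ⟨i, hi, hiP⟩ := hP.prod_mem_iff.1 hprod
    exact absurd hiP (Finset.mem_filter.1 hi).2

theorem sup_le_radical_colon_inf [Finite ι]
    (h : ∀ T : Set ι, Ideal.span (Set.range f) ≤ Ideal.span (f '' T) ∨
      Ideal.span (Set.range g) ≤ Ideal.span (g '' Tᶜ)) :
    Ideal.span (Set.range f) ⊔ Ideal.span (Set.range g) ≤
      ((Ideal.span (Set.range (f * g))).colon
        (Ideal.span (Set.range f) ⊓ Ideal.span (Set.range g) : Ideal S)).radical := by
  refine sup_le ?_ ?_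
  · exact (span_range_left_le_radical_colon h).trans
      (Ideal.radical_mono (Submodule.colon_mono le_rfl inf_le_right))
  · rw [mul_comm f g]
    refine (span_range_left_le_radical_colon fun T => ?_).trans
      (Ideal.radical_mono (Submodule.colon_mono le_rfl inf_le_left))
    simpa only [compl_compl] using (h Tᶜ).symm

theorem inf_le_span_range_mul [(Ideal.span (Set.range g)).IsPrime]
    (hf : ∀ i, Ideal.span (Set.range f) ≤ Ideal.span {f i})
    (hfg : ¬ Ideal.span (Set.range f) ≤ Ideal.span (Set.range g)) :
    Ideal.span (Set.range f) ⊓ Ideal.span (Set.range g) ≤ Ideal.span (Set.range (f * g)) := by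
  obtain ⟨i, hi⟩ : ∃ i, f i ∉ Ideal.span (Set.range g) := by
    by_contra! h
    exact hfg (Ideal.span_le.2 (Set.range_subset_iff.2 h))
  have hcolon : f i ∈ (Ideal.span (Set.range (f * g))).colon
      (Ideal.span (Set.range g) : Ideal S) := by
    rw [Ideal.colon_span, Submodule.mem_colon]
    rintro _ ⟨j, rfl⟩
    obtain ⟨c, hc⟩ := Ideal.mem_span_singleton'.1 (hf j (Ideal.subset_span ⟨i, rfl⟩))
    rw [smul_eq_mul, ← hc, mul_assoc]
    exact Ideal.mul_mem_left _ _ (Ideal.subset_span ⟨j, rfl⟩)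
  rintro x ⟨hxf, hxg⟩
  obtain ⟨y, rfl⟩ := Ideal.mem_span_singleton'.1 (hf i hxf)
  have hy := (Ideal.IsPrime.mem_or_mem ‹_› hxg).resolve_right hi
  rw [mul_comm y]
  exact Submodule.mem_colon.1 hcolon y hy

end Products

section Augmentation

open Algebra.TensorProduct

variable {k A B : Type*} [CommRing k] [CommRing A] [Algebra k A] [CommRing B] [Algebra k B]

theorem surjective_of_algHom_base (ε : A →ₐ[k] k) : Function.Surjective ε :=
  fun c => ⟨algebraMap k A c, ε.commutes c⟩

theorem isPrime_map_includeLeft_ker [IsDomain B] (ε : A →ₐ[k] k) :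
    ((RingHom.ker ε).map (includeLeft : A →ₐ[k] A ⊗[k] B)).IsPrime := by
  have : IsDomain (k ⊗[k] B) := (Algebra.TensorProduct.lid k B).toMulEquiv.isDomain
  rw [← rTensor_ker ε (surjective_of_algHom_base ε)]
  exact RingHom.ker_isPrime _

theorem isPrime_map_includeRight_ker [IsDomain A] (ε : B →ₐ[k] k) :
    ((RingHom.ker ε).map (includeRight : B →ₐ[k] A ⊗[k] B)).IsPrime := by
  have : IsDomain (A ⊗[k] k) := (Algebra.TensorProduct.rid k k A).toMulEquiv.isDomain
  rw [← lTensor_ker ε (surjective_of_algHom_base ε)]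
  exact RingHom.ker_isPrime _

theorem isMaximal_map_ker_sup_map_ker {k A B : Type*} [Field k] [CommRing A] [Algebra k A]
    [CommRing B] [Algebra k B] (εA : A →ₐ[k] k) (εB : B →ₐ[k] k) :
    ((RingHom.ker εA).map (includeLeft : A →ₐ[k] A ⊗[k] B) ⊔
      (RingHom.ker εB).map (includeRight : B →ₐ[k] A ⊗[k] B)).IsMaximal := by
  have hA := surjective_of_algHom_base εA
  have hB := surjective_of_algHom_base εB
  rw [← map_ker εA εB hA hB]
  have hfield : IsField (k ⊗[k] k) :=
    (Algebra.TensorProduct.lid k k).toMulEquiv.isField (Field.toIsField k)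
  let := hfield.toField
  exact RingHom.ker_isMaximal_of_surjective _ (map_surjective εA εB hA hB)

end Augmentation

section SymmetricAlgebra

variable {k M N : Type*} [CommRing k] [AddCommGroup M] [Module k M] [AddCommGroup N] [Module k N]

theorem ker_algebraMapInv_eq_span {A : Set M} (hA : Submodule.span k A = ⊤) :
    RingHom.ker (SymmetricAlgebra.algebraMapInv : SymmetricAlgebra k M →ₐ[k] k) =
      Ideal.span (SymmetricAlgebra.ι k M '' A) := by
  set I := Ideal.span (SymmetricAlgebra.ι k M '' A)
  have hι (m : M) : SymmetricAlgebra.ι k M m ∈ I := by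
    have hle : Submodule.span k A ≤ (I.restrictScalars k).comap (SymmetricAlgebra.ι k M) :=
      Submodule.span_le.2 fun x hx => Ideal.subset_span ⟨x, hx, rfl⟩
    exact hle (hA ▸ Submodule.mem_top)
  have hmk : (Algebra.ofId k _).comp SymmetricAlgebra.algebraMapInv = Ideal.Quotient.mkₐ k I := by
    ext m
    simpa [SymmetricAlgebra.algebraMapInv_ι] using (Ideal.Quotient.eq_zero_iff_mem.2 (hι m)).symm
  refine le_antisymm (fun x hx => ?_) (Ideal.span_le.2 ?_)
  · have hx' := DFunLike.congr_fun hmk x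
    rw [AlgHom.comp_apply, RingHom.mem_ker.1 hx, map_zero] at hx'
    exact Ideal.Quotient.eq_zero_iff_mem.1 hx'.symm
  · rintro _ ⟨m, -, rfl⟩
    exact SymmetricAlgebra.algebraMapInv_ι m

theorem isNoetherianRing_symmetricAlgebra_tensorProduct [IsNoetherianRing k]
    [Module.Finite k M] [Module.Free k M] [Module.Finite k N] [Module.Free k N] :
    IsNoetherianRing (SymmetricAlgebra k M ⊗[k] SymmetricAlgebra k N) := by
  have hM : Algebra.FiniteType k (SymmetricAlgebra k M) := .equiv inferInstance
    (SymmetricAlgebra.equivMvPolynomial (Module.Free.chooseBasis k M)).symm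
  have hN : Algebra.FiniteType k (SymmetricAlgebra k N) := .equiv inferInstance
    (SymmetricAlgebra.equivMvPolynomial (Module.Free.chooseBasis k N)).symm
  have : Algebra.FiniteType k (SymmetricAlgebra k M ⊗[k] SymmetricAlgebra k N) :=
    hM.trans inferInstance
  exact Algebra.FiniteType.isNoetherianRing k _

section Bilinear

variable [Module kᵐᵒᵖ M] [IsCentralScalar k M] [Module kᵐᵒᵖ N] [IsCentralScalar k N]

/-- The degree one component `Sym M → M`, read off from the algebra map `Sym M → k ⊕ M` to the
trivial square-zero extension. -/
noncomputable def linearPart : SymmetricAlgebra k M →ₗ[k] M :=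
  TrivSqZeroExt.sndHom k M ∘ₗ
    (SymmetricAlgebra.lift (TrivSqZeroExt.inrHom k M)).toLinearMap

theorem linearPart_ι (m : M) : linearPart (SymmetricAlgebra.ι k M m) = m := by
  simp [linearPart]

theorem linearPart_mul_ι (x : SymmetricAlgebra k M) (m : M) :
    linearPart (x * SymmetricAlgebra.ι k M m) = SymmetricAlgebra.algebraMapInv x • m := by
  have hfst : (TrivSqZeroExt.fstHom k k M).comp
      (SymmetricAlgebra.lift (TrivSqZeroExt.inrHom k M)) = SymmetricAlgebra.algebraMapInv := by
    ext x
    simp [SymmetricAlgebra.algebraMapInv_ι]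
  simp [← hfst, linearPart, TrivSqZeroExt.snd_mul]

/-- The component of bidegree `(1, 1)`, as a map `Sym M ⊗ Sym N → M ⊗ N`. -/
noncomputable def bilinearPart : SymmetricAlgebra k M ⊗[k] SymmetricAlgebra k N →ₗ[k] M ⊗[k] N :=
  TensorProduct.map linearPart linearPart

theorem bilinearPart_ι_tmul_ι (m : M) (n : N) :
    bilinearPart (SymmetricAlgebra.ι k M m ⊗ₜ[k] SymmetricAlgebra.ι k N n) = m ⊗ₜ n := by
  rw [bilinearPart, TensorProduct.map_tmul, linearPart_ι, linearPart_ι]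

theorem bilinearPart_mul_mem_span_singleton (c : SymmetricAlgebra k M ⊗[k] SymmetricAlgebra k N)
    (m : M) (n : N) :
    bilinearPart (c * SymmetricAlgebra.ι k M m ⊗ₜ[k] SymmetricAlgebra.ι k N n) ∈
      Submodule.span k {m ⊗ₜ[k] n} := by
  induction c with
  | zero => simp
  | add x y hx hy =>
    rw [add_mul, map_add]
    exact add_mem hx hy
  | tmul a b =>
    rw [Algebra.TensorProduct.tmul_mul_tmul, bilinearPart, TensorProduct.map_tmul,
      linearPart_mul_ι, linearPart_mul_ι, TensorProduct.smul_tmul_smul]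
    exact Submodule.smul_mem _ _ (Submodule.mem_span_singleton_self _)

theorem bilinearPart_mem_span_range {ι : Type*} {u : ι → M} {v : ι → N}
    {x : SymmetricAlgebra k M ⊗[k] SymmetricAlgebra k N}
    (hx : x ∈ Ideal.span
      (Set.range fun i => SymmetricAlgebra.ι k M (u i) ⊗ₜ[k] SymmetricAlgebra.ι k N (v i))) :
    bilinearPart x ∈ Submodule.span k (Set.range fun i => u i ⊗ₜ[k] v i) := by
  induction hx using Submodule.closure_induction with
  | zero => simp
  | add x y _ _ hx hy =>
    rw [map_add]
    exact add_mem hx hy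
  | smul_mem c x hx =>
    obtain ⟨i, rfl⟩ := hx
    have hi : u i ⊗ₜ[k] v i ∈ Set.range fun i => u i ⊗ₜ[k] v i := ⟨i, rfl⟩
    exact Submodule.span_mono (Set.singleton_subset_iff.2 hi)
      (bilinearPart_mul_mem_span_singleton c (u i) (v i))

theorem span_range_tmul_eq_top {ι : Type*} {u : ι → M} {v : ι → N}
    (hu : Submodule.span k (Set.range u) = ⊤) (hv : Submodule.span k (Set.range v) = ⊤)
    (h : ∀ i j, SymmetricAlgebra.ι k M (u i) ⊗ₜ[k] SymmetricAlgebra.ι k N (v j) ∈ Ideal.span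
      (Set.range fun i => SymmetricAlgebra.ι k M (u i) ⊗ₜ[k] SymmetricAlgebra.ι k N (v i))) :
    Submodule.span k (Set.range fun i => u i ⊗ₜ[k] v i) = ⊤ := by
  rw [eq_top_iff, ← TensorProduct.map₂_mk_top_top_eq_top, ← hu, ← hv, Submodule.map₂_span_span,
    Submodule.span_le]
  rintro _ ⟨_, ⟨i, rfl⟩, _, ⟨j, rfl⟩, rfl⟩
  have hij := bilinearPart_mem_span_range (h i j)
  rwa [bilinearPart_ι_tmul_ι] at hij

end Bilinear

end SymmetricAlgebra

theorem finrank_lt_card_of_sum_eq_zero {k V ι : Type*} [Field k] [AddCommGroup V] [Module k V]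
    [Fintype ι] [Nonempty ι] {v : ι → V} (hspan : Submodule.span k (Set.range v) = ⊤)
    (hv : ∑ i, v i = 0) : Module.finrank k V < Fintype.card ι := by
  by_contra! hle
  have hli : LinearIndependent k v := by
    rw [linearIndependent_iff_card_le_finrank_span, Set.finrank, hspan, finrank_top]
    exact hle
  exact one_ne_zero (Fintype.linearIndependent_iff.1 hli (fun _ => 1) (by simpa using hv)
    (Classical.arbitrary ι))

section CoordinateRings

open SymmetricAlgebra Algebra.TensorProduct

variable {k : Type*} [Field k] {n : ℕ}

/-- The restriction to `V` of the `i`-th coordinate, as a linear form; `coord V i` is its image in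
`Sym (V^*)`. -/
def coordForm (V : Submodule k (Fin n → k)) (i : Fin n) : Module.Dual k V :=
  LinearMap.proj i ∘ₗ V.subtype

/-- The coordinates in `T` determine the vectors of `V`, i.e. the projection `V → k^T` is injective;
equivalently `T` is spanning in the matroid of `V`. -/
def IsDetermining (V : Submodule k (Fin n → k)) (T : Set (Fin n)) : Prop :=
  ∀ v ∈ V, (∀ i ∈ T, v i = 0) → v = 0

section Subspace

variable {V : Submodule k (Fin n → k)} {T : Set (Fin n)}

theorem isDetermining_univ (V : Submodule k (Fin n → k)) : IsDetermining V Set.univ :=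
  fun _ _ hv => funext fun i => hv i (Set.mem_univ i)

theorem IsDetermining.span_coordForm_eq_top (hT : IsDetermining V T) :
    Submodule.span k (coordForm V '' T) = ⊤ := by
  refine eq_top_iff.2 fun φ _ => ?_
  rw [Set.image_eq_range]
  refine mem_span_of_iInf_ker_le_ker fun v hv => ?_
  have hv0 : v = 0 := Subtype.ext (hT v v.2 fun i hi => (Submodule.mem_iInf _).1 hv ⟨i, hi⟩)
  rw [hv0]
  exact zero_mem _

theorem IsDetermining.span_coord_eq_ker (hT : IsDetermining V T) :
    Ideal.span (coord V '' T) =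
      RingHom.ker (algebraMapInv : CoordRing V →ₐ[k] k) := by
  rw [ker_algebraMapInv_eq_span hT.span_coordForm_eq_top, Set.image_image]
  rfl

end Subspace

section Pairs

variable {W : Submodule k (Fin n → k)} {T : Set (Fin n)}

theorem IsDetermining.span_f_eq_map_ker (hT : IsDetermining W T) :
    Ideal.span (f W '' T) = (RingHom.ker (algebraMapInv : CoordRing W →ₐ[k] k)).map
      (includeLeft : CoordRing W →ₐ[k] PairRing W) := by
  rw [← hT.span_coord_eq_ker, Ideal.map_span, Set.image_image]
  rfl

theorem IsDetermining.span_g_eq_map_ker (hT : IsDetermining (perp W) T) :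
    Ideal.span (g W '' T) = (RingHom.ker (algebraMapInv : CoordRing (perp W) →ₐ[k] k)).map
      (includeRight : CoordRing (perp W) →ₐ[k] PairRing W) := by
  rw [← hT.span_coord_eq_ker, Ideal.map_span, Set.image_image]
  rfl

theorem span_range_f_eq_map_ker (W : Submodule k (Fin n → k)) :
    Ideal.span (Set.range (f W)) = (RingHom.ker (algebraMapInv : CoordRing W →ₐ[k] k)).map
      (includeLeft : CoordRing W →ₐ[k] PairRing W) := by
  rw [← Set.image_univ, (isDetermining_univ W).span_f_eq_map_ker]

theorem span_range_g_eq_map_ker (W : Submodule k (Fin n → k)) :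
    Ideal.span (Set.range (g W)) = (RingHom.ker (algebraMapInv : CoordRing (perp W) →ₐ[k] k)).map
      (includeRight : CoordRing (perp W) →ₐ[k] PairRing W) := by
  rw [← Set.image_univ, (isDetermining_univ (perp W)).span_g_eq_map_ker]

/-- Evaluation of functions on `W × W^⊥` at the point `(w, y)`. -/
noncomputable def evalAt (w : W) (y : perp W) : PairRing W →ₐ[k] k :=
  Algebra.TensorProduct.lift (SymmetricAlgebra.lift (Module.Dual.eval k W w))
    (SymmetricAlgebra.lift (Module.Dual.eval k (perp W) y)) fun _ _ => .all _ _

theorem evalAt_f (w : W) (y : perp W) (i : Fin n) : evalAt w y (f W i) = (w : Fin n → k) i := by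
  simp [evalAt, f, coord]

theorem evalAt_g (w : W) (y : perp W) (i : Fin n) : evalAt w y (g W i) = (y : Fin n → k) i := by
  simp [evalAt, g, coord]

theorem not_span_range_f_le_span_range_g (hW : W ≠ ⊥) :
    ¬ Ideal.span (Set.range (f W)) ≤ Ideal.span (Set.range (g W)) := by
  obtain ⟨w, hw, hw0⟩ := Submodule.exists_mem_ne_zero_of_ne_bot hW
  intro hle
  have hg : Ideal.span (Set.range (g W)) ≤ RingHom.ker (evalAt ⟨w, hw⟩ 0) := by
    rw [Ideal.span_le]
    rintro _ ⟨i, rfl⟩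
    exact evalAt_g _ _ i
  exact hw0 (funext fun i => (evalAt_f ⟨w, hw⟩ 0 i).symm.trans
    (hg (hle (Ideal.subset_span ⟨i, rfl⟩))))

theorem not_span_range_g_le_span_range_f (hW : perp W ≠ ⊥) :
    ¬ Ideal.span (Set.range (g W)) ≤ Ideal.span (Set.range (f W)) := by
  obtain ⟨y, hy, hy0⟩ := Submodule.exists_mem_ne_zero_of_ne_bot hW
  intro hle
  have hf : Ideal.span (Set.range (f W)) ≤ RingHom.ker (evalAt 0 ⟨y, hy⟩) := by
    rw [Ideal.span_le]
    rintro _ ⟨i, rfl⟩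
    exact evalAt_f _ _ i
  exact hy0 (funext fun i => (evalAt_g 0 ⟨y, hy⟩ i).symm.trans
    (hf (hle (Ideal.subset_span ⟨i, rfl⟩))))

theorem finrank_add_finrank_perp (W : Submodule k (Fin n → k)) :
    Module.finrank k W + Module.finrank k (perp W) = n := by
  have hperp : perp W = W.dualAnnihilator.comap (dotProductEquiv k (Fin n)).toLinearMap := by
    ext y
    simp [perp, Submodule.mem_dualAnnihilator, dotProduct, mul_comm]
  have hdual : Module.finrank k (perp W) = Module.finrank k W.dualAnnihilator := by
    rw [hperp]
    exact ((dotProductEquiv k (Fin n)).ofSubmodule' W.dualAnnihilator).finrank_eq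
  rw [hdual, Subspace.finrank_add_finrank_dualAnnihilator_eq, Module.finrank_fin_fun]

theorem sum_coordForm_tmul_coordForm_perp (W : Submodule k (Fin n → k)) :
    ∑ i, coordForm W i ⊗ₜ[k] coordForm (perp W) i = 0 := by
  apply (TensorProduct.dualDistribEquiv k W (perp W)).injective
  rw [map_zero, map_sum]
  apply TensorProduct.ext'
  intro w y
  simpa [TensorProduct.dualDistribEquivOfBasis, coordForm] using y.2 w w.2

theorem isDetermining_perp_compl
    (hT : Function.Surjective fun (w : W) (i : T) => (w : Fin n → k) i) :
    IsDetermining (perp W) Tᶜ := by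
  classical
  intro y hy hyT
  funext i
  by_cases hi : i ∈ T
  · obtain ⟨w, hw⟩ := hT (Pi.single ⟨i, hi⟩ 1)
    have hwy : ∀ j, (w : Fin n → k) j * y j = if j = i then y j else 0 := by
      intro j
      by_cases hj : j ∈ T
      · have hwj := congr_fun hw ⟨j, hj⟩
        simp only [Pi.single_apply, Subtype.mk.injEq] at hwj
        rw [hwj, ite_mul, one_mul, zero_mul]
      · have hji : j ≠ i := fun h => hj (h ▸ hi)
        rw [hyT j hj, mul_zero, if_neg hji]
    simpa [hwy] using hy w w.2
  · exact hyT i hi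

theorem isPrime_span_range_f (W : Submodule k (Fin n → k)) :
    (Ideal.span (Set.range (f W))).IsPrime := by
  rw [span_range_f_eq_map_ker]
  exact isPrime_map_includeLeft_ker _

theorem isPrime_span_range_g (W : Submodule k (Fin n → k)) :
    (Ideal.span (Set.range (g W))).IsPrime := by
  rw [span_range_g_eq_map_ker]
  exact isPrime_map_includeRight_ker _

theorem isMaximal_span_range_f_sup_span_range_g (W : Submodule k (Fin n → k)) :
    (Ideal.span (Set.range (f W)) ⊔ Ideal.span (Set.range (g W))).IsMaximal := by
  rw [span_range_f_eq_map_ker, span_range_g_eq_map_ker]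
  exact isMaximal_map_ker_sup_map_ker _ _

theorem pairIdeal_le_inf (W : Submodule k (Fin n → k)) :
    pairIdeal W ≤ Ideal.span (Set.range (f W)) ⊓ Ideal.span (Set.range (g W)) :=
  span_range_mul_le_inf

theorem finrank_mul_finrank_perp_lt (hn : 0 < n)
    (hle : Ideal.span (Set.range (f W)) ⊓ Ideal.span (Set.range (g W)) ≤ pairIdeal W) :
    Module.finrank k W * Module.finrank k (perp W) < n := by
  have hmul : ∀ i j, f W i * g W j =
      ι k _ (coordForm W i) ⊗ₜ[k] ι k _ (coordForm (perp W) j) := fun i j => by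
    simp [f, g, coord, coordForm]
  have hspan (V : Submodule k (Fin n → k)) : Submodule.span k (Set.range (coordForm V)) = ⊤ := by
    rw [← Set.image_univ, (isDetermining_univ V).span_coordForm_eq_top]
  have htop := span_range_tmul_eq_top (hspan W) (hspan (perp W)) fun i j => by
    simp only [← hmul]
    exact hle ⟨Ideal.mul_mem_right _ _ (Ideal.subset_span ⟨i, rfl⟩),
      Ideal.mul_mem_left _ _ (Ideal.subset_span ⟨j, rfl⟩)⟩
  have : Nonempty (Fin n) := ⟨⟨0, hn⟩⟩
  have hlt := finrank_lt_card_of_sum_eq_zero (k := k)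
    (V := Module.Dual k W ⊗[k] Module.Dual k (perp W)) htop (sum_coordForm_tmul_coordForm_perp W)
  rwa [Module.finrank_tensorProduct, Subspace.dual_finrank_eq, Subspace.dual_finrank_eq,
    Fintype.card_fin] at hlt

theorem linIdeal_univ_empty (W : Submodule k (Fin n → k)) :
    linIdeal W Set.univ ∅ = Ideal.span (Set.range (f W)) := by
  simp [linIdeal]

theorem linIdeal_empty_univ (W : Submodule k (Fin n → k)) :
    linIdeal W ∅ Set.univ = Ideal.span (Set.range (g W)) := by
  simp [linIdeal]

theorem linIdeal_univ_univ (W : Submodule k (Fin n → k)) :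
    linIdeal W Set.univ Set.univ =
      Ideal.span (Set.range (f W)) ⊔ Ideal.span (Set.range (g W)) := by
  simp [linIdeal]

end Pairs

section Realization

theorem uniformMatroid_indep_iff {r : ℕ} {I : Set (Fin n)} :
    (uniformMatroid r n).Indep I ↔ I.ncard ≤ r := by
  simp [uniformMatroid]

theorem uniformMatroid_isBase {r : ℕ} {B : Set (Fin n)} (hB : B.ncard = r) :
    (uniformMatroid r n).IsBase B := by
  rw [Matroid.isBase_iff_maximal_indep]
  refine ⟨uniformMatroid_indep_iff.2 hB.le, fun J hJ hBJ => ?_⟩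
  exact (Set.eq_of_subset_of_ncard_le hBJ ((uniformMatroid_indep_iff.1 hJ).trans hB.ge)).ge

variable {r : ℕ} {W : Submodule k (Fin n → k)} {T : Set (Fin n)}

namespace IsRealization

theorem isDetermining (hW : IsRealization W (uniformMatroid r n)) (hT : r ≤ T.ncard) :
    IsDetermining W T := by
  obtain ⟨B, hBT, hB⟩ := Set.exists_subset_card_eq hT
  have hinj := ((hW.2 B).2 (uniformMatroid_isBase hB)).injective
  intro w hw hwT
  have hw0 : (⟨w, hw⟩ : W) = 0 := hinj (funext fun i => hwT i (hBT i.2))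
  exact congr_arg Subtype.val hw0

theorem surjective_of_ncard_le (hW : IsRealization W (uniformMatroid r n)) (hr : r ≤ n)
    (hT : T.ncard ≤ r) : Function.Surjective fun (w : W) (i : T) => (w : Fin n → k) i := by
  obtain ⟨B, hTB, -, hB⟩ := Set.exists_subsuperset_card_eq (Set.subset_univ T) hT
    (by simpa [Set.ncard_univ] using hr)
  have hsurj := ((hW.2 B).2 (uniformMatroid_isBase hB)).surjective
  exact (Function.Injective.surjective_comp_right (γ := k)
    (Set.inclusion_injective hTB)).comp hsurj

theorem isDetermining_perp (hW : IsRealization W (uniformMatroid r n)) (hr : r ≤ n)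
    (hT : n ≤ T.ncard + r) : IsDetermining (perp W) T := by
  have hcard := Set.ncard_add_ncard_compl T
  rw [Nat.card_fin] at hcard
  simpa using isDetermining_perp_compl (hW.surjective_of_ncard_le hr (T := Tᶜ) (by omega))

theorem finrank_eq (hW : IsRealization W (uniformMatroid r n)) (hr : r ≤ n) :
    Module.finrank k W = r := by
  obtain ⟨B, -, hB⟩ := Set.exists_subset_card_eq (s := (Set.univ : Set (Fin n))) (n := r)
    (by simpa [Set.ncard_univ] using hr)
  have hbij := (hW.2 B).2 (uniformMatroid_isBase hB)
  have := Fintype.ofFinite B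
  have hrank := (LinearEquiv.ofBijective (LinearMap.pi fun i : B => coordForm W i) hbij).finrank_eq
  rw [hrank, Module.finrank_pi, ← Nat.card_eq_fintype_card, Nat.card_coe_set_eq, hB]

theorem finrank_perp_eq (hW : IsRealization W (uniformMatroid r n)) (hr : r ≤ n) :
    Module.finrank k (perp W) = n - r := by
  have hsum := finrank_add_finrank_perp W
  rw [hW.finrank_eq hr] at hsum
  omega

theorem ne_bot (hW : IsRealization W (uniformMatroid r n)) (hr0 : 0 < r) (hr : r ≤ n) :
    W ≠ ⊥ := by
  rintro rfl
  simpa [hr0.ne] using hW.finrank_eq hr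

theorem perp_ne_bot (hW : IsRealization W (uniformMatroid r n)) (hrn : r < n) :
    perp W ≠ ⊥ := by
  intro hbot
  have hrank := hW.finrank_perp_eq hrn.le
  rw [hbot, finrank_bot] at hrank
  omega

theorem span_range_f_le (hW : IsRealization W (uniformMatroid r n)) (hT : r ≤ T.ncard) :
    Ideal.span (Set.range (f W)) ≤ Ideal.span (f W '' T) := by
  rw [span_range_f_eq_map_ker, (hW.isDetermining hT).span_f_eq_map_ker]

theorem span_range_g_le (hW : IsRealization W (uniformMatroid r n)) (hr : r ≤ n)
    (hT : n ≤ T.ncard + r) : Ideal.span (Set.range (g W)) ≤ Ideal.span (g W '' T) := by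
  rw [span_range_g_eq_map_ker, (hW.isDetermining_perp hr hT).span_g_eq_map_ker]

theorem sup_le_radical_colon (hW : IsRealization W (uniformMatroid r n)) (hr : r ≤ n) :
    Ideal.span (Set.range (f W)) ⊔ Ideal.span (Set.range (g W)) ≤ ((pairIdeal W).colon
      (Ideal.span (Set.range (f W)) ⊓ Ideal.span (Set.range (g W)) : Ideal _)).radical := by
  refine sup_le_radical_colon_inf fun T => ?_
  rcases le_total r T.ncard with hT | hT
  · exact .inl (hW.span_range_f_le hT)
  · have hcard := Set.ncard_add_ncard_compl T
    rw [Nat.card_fin] at hcard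
    exact .inr (hW.span_range_g_le hr (by omega))

theorem inf_le_pairIdeal_iff (hW : IsRealization W (uniformMatroid r n)) (hr0 : 0 < r)
    (hrn : r < n) :
    Ideal.span (Set.range (f W)) ⊓ Ideal.span (Set.range (g W)) ≤ pairIdeal W ↔
      r = 1 ∨ r + 1 = n := by
  constructor
  · intro hle
    have hlt := finrank_mul_finrank_perp_lt (hr0.trans hrn) hle
    rw [hW.finrank_eq hrn.le, hW.finrank_perp_eq hrn.le] at hlt
    by_contra! hne
    obtain ⟨a, rfl⟩ := Nat.exists_eq_add_of_le (show 2 ≤ r by omega)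
    obtain ⟨b, rfl⟩ := Nat.exists_eq_add_of_le (show 2 + a + 2 ≤ n by omega)
    rw [show 2 + a + 2 + b - (2 + a) = 2 + b by omega] at hlt
    nlinarith
  · rintro (rfl | rfl)
    · have := isPrime_span_range_g W
      refine inf_le_span_range_mul (fun i => ?_)
        (not_span_range_f_le_span_range_g (hW.ne_bot hr0 hrn.le))
      simpa using hW.span_range_f_le (T := {i}) (by simp)
    · have := isPrime_span_range_f W
      have hgf := inf_le_span_range_mul (fun i => ?_)
        (not_span_range_g_le_span_range_f (hW.perp_ne_bot hrn))
      · rwa [inf_comm, mul_comm] at hgf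
      · simpa using hW.span_range_g_le hrn.le (T := {i}) (by simp [add_comm])

end IsRealization

end Realization

end CoordinateRings

end IdealOfPairs

theorem corollary3p13 {k : Type*} [Field k] {n r : ℕ} (hr : r ≤ n)
    (W : Submodule k (Fin n → k))
    (hW : IdealOfPairs.IsRealization W (IdealOfPairs.uniformMatroid r n)) :
    associatedPrimes (IdealOfPairs.PairRing W)
        (IdealOfPairs.PairRing W ⧸ IdealOfPairs.pairIdeal W) ⊆
      {IdealOfPairs.linIdeal W Set.univ ∅, IdealOfPairs.linIdeal W ∅ Set.univ,
        IdealOfPairs.linIdeal W Set.univ Set.univ} ∧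
    (0 < r → r < n →
      IdealOfPairs.linIdeal W Set.univ ∅ ∈ associatedPrimes (IdealOfPairs.PairRing W)
        (IdealOfPairs.PairRing W ⧸ IdealOfPairs.pairIdeal W) ∧
      IdealOfPairs.linIdeal W ∅ Set.univ ∈ associatedPrimes (IdealOfPairs.PairRing W)
        (IdealOfPairs.PairRing W ⧸ IdealOfPairs.pairIdeal W) ∧
      (IdealOfPairs.linIdeal W Set.univ Set.univ ∈ associatedPrimes (IdealOfPairs.PairRing W)
        (IdealOfPairs.PairRing W ⧸ IdealOfPairs.pairIdeal W) ↔ 2 ≤ r ∧ r + 2 ≤ n)) := by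
  have hp := IdealOfPairs.isPrime_span_range_f W
  have hq := IdealOfPairs.isPrime_span_range_g W
  have hm := IdealOfPairs.isMaximal_span_range_f_sup_span_range_g W
  have ha := IdealOfPairs.pairIdeal_le_inf W
  have hcolon := hW.sup_le_radical_colon hr
  rw [IdealOfPairs.linIdeal_univ_empty, IdealOfPairs.linIdeal_empty_univ,
    IdealOfPairs.linIdeal_univ_univ]
  refine ⟨IdealOfPairs.associatedPrimes_quotient_subset_of_sup_le_radical hp hq hm ha hcolon,
    fun hr0 hrn => ?_⟩
  have hpq := IdealOfPairs.not_span_range_f_le_span_range_g (hW.ne_bot hr0 hr)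
  have hqp := IdealOfPairs.not_span_range_g_le_span_range_f (hW.perp_ne_bot hrn)
  have : IsNoetherianRing (IdealOfPairs.PairRing W) :=
    IdealOfPairs.isNoetherianRing_symmetricAlgebra_tensorProduct
  have hmin := IdealOfPairs.minimalPrimes_subset_associatedPrimes_quotient
    (IdealOfPairs.pairIdeal W)
  refine ⟨hmin ?_, hmin ?_, ?_⟩
  · exact IdealOfPairs.mem_minimalPrimes_of_sup_le_radical hp (ha.trans inf_le_left) hqp hcolon
  · rw [sup_comm, inf_comm] at hcolon
    exact IdealOfPairs.mem_minimalPrimes_of_sup_le_radical hq (ha.trans inf_le_right) hpq hcolon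
  · rw [IdealOfPairs.sup_mem_associatedPrimes_quotient_iff hp hq hm ha hpq hqp hcolon,
      hW.inf_le_pairIdeal_iff hr0 hrn]
    omega
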